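/- A loose graph $\Gamma$ consists of a set $V$ of vertices and a set $E$ of edges, in which every edge has $0$, $1$ or $2$ vertices and two distinct vertices are joined by at most one edge; let $\Gamma$ be finite (that is, $V$ and $E$ are finite). The completion $\overline{\Gamma}$ is the graph obtained from $\Gamma$ by adding one new vertex on each edge with one vertex and two new vertices on each edge without vertices. Let $\overline{V}$ be the vertex set of $\overline{\Gamma}$, let $k$ be a finite field, and let $\mathbb{P}$ be the projective space over $k$ with homogeneous coordinates $(x_v)_{v\in\overline{V}}$. For $v\in\overline{V}$ let $$\mathbb{A}_v=\{x\in\mathbb{P} : x_v\neq 0,\ x_w=0 \text{ for all } w\neq v \text{ not adjacent to } v \text{ in } \overline{\Gamma}\}$$ be the affine space defined by the star of $v$, and let $$\mathcal{F}_k(\Gamma)=\Big(\bigcup_{v\in\overline{V}}\mathbb{A}_v\Big)\setminus\{\text{the coordinate points of the added vertices}\},$$ a constructible subset of $\mathbb{P}$. Let $K_0(\mathrm{Sch}_k)$ be the Grothendieck ring of $k$-schemes of finite type: it is generated by the isomorphism classes $[X]$ of such schemes, with $[X]=[X\setminus Z]+[Z]$ for each closed subscheme $Z$ of $X$, $[X]\cdot[Y]=[X\times_k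 Y]$ and $[\mathrm{Spec}\,k]=1$. Let $\mathbb{L}=[\mathbb{A}^1_k]$. The class $[C]$ of a constructible subset $C$ of a $k$-scheme of finite type is $\sum_i [X_i]$ for any decomposition of $C$ into finitely many pairwise disjoint locally closed subschemes $X_i$. Theorem. For every finite loose graph $\Gamma$ and every finite field $k$, the class $[\mathcal{F}_k(\Gamma)]\in K_0(\mathrm{Sch}_k)$ is well defined (such a decomposition exists, and the sum does not depend on it) and lies in $\mathbb{Z}[\mathbb{L}]$, the subring generated by $\mathbb{L}$. In other words, $[\mathcal{F}_k(\Gamma)]$ is a virtual mixed Tate motive. -/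

import Mathlib

open CategoryTheory CategoryTheory.Limits AlgebraicGeometry
open scoped AlgebraicGeometry

universe u

noncomputable section

/-- A loose graph with vertex set `V` and edge set `E`: every edge has `0`, `1` or `2` vertices
(edges with at most one vertex are the loose edges), and, as in any (simple) graph, two distinct
vertices are joined by at most one edge. Several loose edges may pass through the same vertex. -/
structure LooseGraph (V E : Type u) where
  /-- The set of vertices of an edge. -/
  ends : E → Finset V
  card_ends_le : ∀ e, (ends e).card ≤ 2
  simple : ∀ e e', (ends e).card = 2 → ends e = ends e' → e = e'

namespace LooseGraph

variable {V E : Type u} (Γ : LooseGraph V E)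

/-- The vertices added when `Γ` is completed to a graph: one new vertex on each edge with one
vertex, two new vertices on each edge without vertices, none on the other edges. -/
abbrev Added : Type u := Σ e : E, Fin (2 - (Γ.ends e).card)

/-- The vertices of the completion of `Γ`. -/
abbrev Vert : Type u := V ⊕ Γ.Added

/-- Incidence of vertices and edges in the completion of `Γ`. -/
def Inc : Γ.Vert → E → Prop
  | Sum.inl v, e => v ∈ Γ.ends e
  | Sum.inr w, e => w.1 = e

/-- The completion of a loose graph `Γ`: the (ordinary) graph that one obtains by adding the
missing vertices on the loose edges of `Γ`. -/
def completion : SimpleGraph Γ.Vert where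
  Adj u w := u ≠ w ∧ ∃ e, Γ.Inc u e ∧ Γ.Inc w e
  symm := ⟨fun _ _ h => ⟨h.1.symm, h.2.imp fun _ he => ⟨he.2, he.1⟩⟩⟩
  loopless := ⟨fun _ h => h.1 rfl⟩

end LooseGraph

section ProjectiveSpace

attribute [local instance] MvPolynomial.gradedAlgebra

variable (σ k : Type u) [Field k]

/-- The projective space over `k` with homogeneous coordinates indexed by `σ`, as a scheme. -/
def projSpace : Scheme.{u} :=
  Proj (MvPolynomial.homogeneousSubmodule σ k)

/-- The structure morphism of the projective space. -/
def projSpaceHom : projSpace σ k ⟶ Spec (CommRingCat.of k) :=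
  Proj.toSpecZero (MvPolynomial.homogeneousSubmodule σ k) ≫
    Spec.map (CommRingCat.ofHom
      (algebraMap k (MvPolynomial.homogeneousSubmodule σ k 0)))

/-- The projective space as a `k`-scheme. -/
def projSpaceOver : Over (Spec (CommRingCat.of k)) :=
  Over.mk (projSpaceHom σ k)

/-- The open subscheme of the projective space where the coordinate `x_s` does not vanish. -/
def coordOpen (s : σ) : (projSpace σ k).Opens :=
  Proj.basicOpen (MvPolynomial.homogeneousSubmodule σ k) (MvPolynomial.X s)

end ProjectiveSpace

namespace LooseGraph

variable {V E : Type u} (Γ : LooseGraph V E) (k : Type u) [Field k]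

/-- The affine space defined by the star of a vertex `v` of the completion of `Γ`, inside the
projective space on the vertices of the completion: `x_v ≠ 0`, and `x_w = 0` for each `w` that is
neither `v` nor adjacent to `v`. -/
def starAffine (v : Γ.Vert) : Set (projSpace Γ.Vert k) :=
  {x | x ∈ coordOpen Γ.Vert k v ∧
    ∀ w, w ≠ v → ¬ Γ.completion.Adj v w → x ∉ coordOpen Γ.Vert k w}

/-- The closed point of the projective space that corresponds to the vertex `v`: the
only nonzero coordinate is `x_v`. -/
def vertexPoint (v : Γ.Vert) : Set (projSpace Γ.Vert k) :=
  {x | ∀ w, x ∈ coordOpen Γ.Vert k w ↔ w = v}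

/-- `F_k(Γ)`, as a subset of the projective `k`-space on the vertices of the completion of `Γ`:
the union of the affine spaces defined by the stars of the vertices, without the closed points
that correspond to the added vertices. (The star of the added vertex of an edge with one vertex
contributes nothing new; an edge without vertices contributes a projective line without two
points, that is, a multiplicative group.) -/
def functorF : Set (projSpace Γ.Vert k) :=
  (⋃ v : Γ.Vert, Γ.starAffine k v) \ ⋃ w : Γ.Added, Γ.vertexPoint k (Sum.inr w)

end LooseGraph

section GrothendieckRing

variable (k : Type u) [Field k]

/-- Schemes of finite type over the field `k`. -/
structure FTScheme where
  obj : Over (Spec (CommRingCat.of k))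
  locallyOfFiniteType : LocallyOfFiniteType obj.hom
  quasiCompact : QuasiCompact obj.hom

/-- The relations that define the Grothendieck ring of `k`-schemes of finite type. -/
inductive K0Rel : FreeCommRing (FTScheme k) → FreeCommRing (FTScheme k) → Prop
  /-- Isomorphic `k`-schemes have the same class. -/
  | iso (X Y : FTScheme k) (e : X.obj ≅ Y.obj) :
      K0Rel (FreeCommRing.of X) (FreeCommRing.of Y)
  /-- `[X] = [X ∖ Z] + [Z]` for a closed subscheme `Z` of `X`, where `U` is the open subscheme
  of `X` on the complement of `Z`. -/
  | scissor (X U Z : FTScheme k) (j : U.obj ⟶ X.obj) (i : Z.obj ⟶ X.obj)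
      (hj : IsOpenImmersion j.left) (hi : IsClosedImmersion i.left)
      (h : Set.range j.left = (Set.range i.left)ᶜ) :
      K0Rel (FreeCommRing.of X) (FreeCommRing.of U + FreeCommRing.of Z)
  /-- `[X] · [Y] = [X ×ₖ Y]`. -/
  | prod (X Y P : FTScheme k) (p : P.obj.left ⟶ X.obj.left) (q : P.obj.left ⟶ Y.obj.left)
      (h : IsPullback p q X.obj.hom Y.obj.hom) (hP : p ≫ X.obj.hom = P.obj.hom) :
      K0Rel (FreeCommRing.of X * FreeCommRing.of Y) (FreeCommRing.of P)
  /-- The class of `Spec k` is the unit. -/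
  | one (X : FTScheme k) (h : IsIso X.obj.hom) : K0Rel (FreeCommRing.of X) 1

/-- The Grothendieck ring `K₀(Sch_k)` of `k`-schemes of finite type. -/
abbrev K0 : Type (u + 1) :=
  FreeCommRing (FTScheme k) ⧸ Ideal.ofRel (K0Rel k)

variable {k}

/-- The class `[X]` of a `k`-scheme of finite type. -/
def K0.cls (X : FTScheme k) : K0 k :=
  Ideal.Quotient.mk (Ideal.ofRel (K0Rel k)) (FreeCommRing.of X)

variable (k) in
/-- The affine line over `k`. -/
def affineLine : FTScheme k where
  obj := Over.mk (𝔸(PUnit.{u + 1}; Spec (CommRingCat.of k)) ↘ Spec (CommRingCat.of k))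
  locallyOfFiniteType := by dsimp; infer_instance
  quasiCompact := by dsimp; infer_instance

variable (k) in
/-- The class `𝕃` of the affine line. -/
def K0.lefschetz : K0 k := K0.cls (affineLine k)

/-- `c` is a class in `K₀(Sch_k)` of the subset `C` of the `k`-scheme `P`: the set `C` is a finite
disjoint union of locally closed subsets of `P`, each the underlying set of a subscheme `X i` of
finite type, and `c` is the sum of the classes `[X i]`. Subsets with such a class are the
constructible ones (for `P` of finite type); a subscheme `X` of finite type has the class `[X]`. -/
def IsClassOf (P : Over (Spec (CommRingCat.of k))) (C : Set P.left) (c : K0 k) : Prop :=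
  ∃ (n : ℕ) (X : Fin n → FTScheme k) (f : ∀ i, (X i).obj ⟶ P),
    (∀ i, IsImmersion (f i).left) ∧
    (∀ i j, i ≠ j → Disjoint (Set.range (f i).left) (Set.range (f j).left)) ∧
    (⋃ i, Set.range (f i).left) = C ∧
    c = ∑ i, K0.cls (X i)

end GrothendieckRing

end

/-! Whether a point lies in `functorF` depends only on which homogeneous coordinates vanish at it.
So the set is a finite disjoint union of strata `supportStratum k S`, where the coordinates in a
nonempty `S` are nonzero and the others are zero. Each stratum is a split torus; its class is a
polynomial in `𝕃` because tori arise from affine spaces by removing coordinate hyperplanes one at a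
time (`HasTateClass.sdiff`, `hasTateClass_torusChart`). The affine spaces are the subschemes
`linearChart`, of class `𝕃 ^ n` by `K0.clsHom_specHom_mvPolynomial`.

Independence of the decomposition (`IsClassOf.unique`) follows by refining two decompositions to the
fibre products of their pieces. This needs additivity over arbitrary finite locally closed
partitions (`K0.clsHom_eq_sum`), while the defining relation only cuts a scheme into an open part
and its closed complement. The gap is bridged by cutting successively along finitely many open sets
whose membership pattern determines the piece. -/

noncomputable section

/-- A `k`-scheme is of finite type. -/
class IsFTOver {k : Type u} [Field k] {X : Scheme.{u}} (s : X ⟶ Spec (CommRingCat.of k)) :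
    Prop where
  locallyOfFiniteType : LocallyOfFiniteType s
  quasiCompact : QuasiCompact s

namespace IsFTOver

variable {k : Type u} [Field k] {X Y : Scheme.{u}} (s : X ⟶ Spec (CommRingCat.of k)) [IsFTOver s]

include s in
lemma isNoetherian : IsNoetherian X :=
  have := locallyOfFiniteType (s := s)
  have := quasiCompact (s := s)
  have : IsLocallyNoetherian X := LocallyOfFiniteType.isLocallyNoetherian s
  have : CompactSpace X := QuasiCompact.compactSpace_of_compactSpace s
  { }

instance comp_of_isImmersion (f : Y ⟶ X) [IsImmersion f] : IsFTOver (f ≫ s) :=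
  have := locallyOfFiniteType (s := s)
  have := isNoetherian s
  -- Subspaces of a Noetherian space are Noetherian, hence quasi-compact.
  have : TopologicalSpace.NoetherianSpace Y := f.isEmbedding.isInducing.noetherianSpace
  { locallyOfFiniteType := inferInstance
    quasiCompact := inferInstance }

instance (X : FTScheme k) : IsFTOver X.obj.hom where
  locallyOfFiniteType := X.locallyOfFiniteType
  quasiCompact := X.quasiCompact

end IsFTOver

/-! ### Additivity of classes over locally closed partitions -/

namespace K0

variable {k : Type u} [Field k]

/-- The class of a `k`-scheme of finite type, given by its structure morphism. -/
def clsHom {X : Scheme.{u}} (s : X ⟶ Spec (CommRingCat.of k)) [h : IsFTOver s] : K0 k :=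
  cls ⟨Over.mk s, h.1, h.2⟩

lemma cls_eq_clsHom (X : FTScheme k) : cls X = clsHom X.obj.hom := rfl

lemma clsHom_congr {X : Scheme.{u}} {s t : X ⟶ Spec (CommRingCat.of k)} [IsFTOver s] [IsFTOver t]
    (h : s = t) : clsHom s = clsHom t := by
  subst h; rfl

variable {X Y U Z P : Scheme.{u}} (s : X ⟶ Spec (CommRingCat.of k)) [IsFTOver s]
  (t : Y ⟶ Spec (CommRingCat.of k)) [IsFTOver t]

lemma clsHom_scissor (j : U ⟶ X) (i : Z ⟶ X) [hj : IsOpenImmersion j] [hi : IsClosedImmersion i]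
    (h : Set.range j = (Set.range i)ᶜ) : clsHom s = clsHom (j ≫ s) + clsHom (i ≫ s) :=
  Ideal.Quotient.eq.mpr <| Submodule.subset_span
    ⟨_, _, .scissor ⟨Over.mk s, _, _⟩ ⟨Over.mk (j ≫ s), _, _⟩ ⟨Over.mk (i ≫ s), _, _⟩
      (Over.homMk j) (Over.homMk i) hj hi h, by ring⟩

lemma clsHom_mul (p : P ⟶ X) (q : P ⟶ Y) (r : P ⟶ Spec (CommRingCat.of k)) [IsFTOver r]
    (h : IsPullback p q s t) (hr : p ≫ s = r) : clsHom s * clsHom t = clsHom r :=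
  Ideal.Quotient.eq.mpr <| Submodule.subset_span
    ⟨_, _, .prod ⟨Over.mk s, _, _⟩ ⟨Over.mk t, _, _⟩ ⟨Over.mk r, _, _⟩ p q h hr, by ring⟩

lemma clsHom_one [h : IsIso s] : clsHom s = 1 :=
  Ideal.Quotient.eq.mpr <| Submodule.subset_span ⟨_, _, .one ⟨Over.mk s, _, _⟩ h, by ring⟩

lemma clsHom_eq_zero [IsEmpty X] : clsHom s = 0 := by
  -- The empty scheme is its own open part and its own closed complement: `[∅] = [∅] + [∅]`.
  have := clsHom_scissor s (𝟙 X) (𝟙 X) (Subsingleton.elim _ _)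
  rw [clsHom_congr (Category.id_comp s)] at this
  simpa using this

/-- A surjective immersion is closed with empty complement, so the scissor relation applies. In
particular nilpotents do not affect the class. -/
lemma clsHom_comp_of_range_eq_univ (f : Y ⟶ X) [IsImmersion f] (hf : Set.range f = Set.univ) :
    clsHom (f ≫ s) = clsHom s := by
  have : IsClosedImmersion f :=
    IsClosedImmersion.of_isPreimmersion _ (by rw [hf]; exact isClosed_univ)
  have : IsEmpty ((⊥ : X.Opens) : Scheme) := inferInstanceAs (IsEmpty (∅ : Set X))
  rw [clsHom_scissor s (⊥ : X.Opens).ι f, clsHom_eq_zero ((⊥ : X.Opens).ι ≫ s), zero_add]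
  rw [hf, Set.compl_univ]
  exact Set.range_eq_empty _

/-- Two immersions with the same image have sources of the same class. -/
lemma clsHom_eq_of_range_eq (p : P ⟶ Spec (CommRingCat.of k)) (f : X ⟶ P) (g : Y ⟶ P)
    [IsImmersion f] [IsImmersion g] (hf : f ≫ p = s) (hg : g ≫ p = t)
    (h : Set.range f = Set.range g) : clsHom s = clsHom t := by
  -- The fibre product of `X` and `Y` over `P` maps to both by surjective immersions.
  rw [← clsHom_comp_of_range_eq_univ s (pullback.fst f g),
    ← clsHom_comp_of_range_eq_univ t (pullback.snd f g)]
  · exact clsHom_congr (by rw [← hf, ← hg, pullback.condition_assoc])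
  · rw [Scheme.Pullback.range_snd, h, Set.preimage_range]
  · rw [Scheme.Pullback.range_fst, ← h, Set.preimage_range]

/-- The class of a scheme is the sum of the classes of an open subset and of its complement. -/
lemma clsHom_eq_add (j : U ⟶ X) (i : Z ⟶ X) [IsImmersion j] [IsImmersion i]
    (hj : IsOpen (Set.range j)) (h : Set.range j = (Set.range i)ᶜ) :
    clsHom s = clsHom (j ≫ s) + clsHom (i ≫ s) := by
  have : IsClosedImmersion i :=
    IsClosedImmersion.of_isPreimmersion _ (by rw [← isOpen_compl_iff, ← h]; exact hj)
  -- `j` is an immersion with open image but perhaps not an open immersion; `V` has the same image,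
  -- hence the same class.
  let V : X.Opens := ⟨_, hj⟩
  have hV : Set.range V.ι = Set.range j := V.range_ι
  rw [clsHom_scissor s V.ι i (hV.trans h),
    clsHom_eq_of_range_eq (V.ι ≫ s) (j ≫ s) s V.ι j rfl rfl hV]

/-- Induction on the number of open sets that separate the pieces: cut `X` and every piece along `U
0`. When no open set is left, saturation forces one piece to be everything and the others to be
empty. -/
lemma clsHom_eq_sum_of_saturated (m : ℕ) : ∀ {X : Scheme.{u}} (s : X ⟶ Spec (CommRingCat.of k))
    [IsFTOver s] (U : Fin m → X.Opens) {ι : Type} [Fintype ι] (Y : ι → Scheme.{u})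
    (f : ∀ i, Y i ⟶ X) [∀ i, IsImmersion (f i)]
    (_ : ∀ i j, i ≠ j → Disjoint (Set.range (f i)) (Set.range (f j)))
    (_ : (⋃ i, Set.range (f i)) = Set.univ)
    (_ : ∀ x y, (∀ j, x ∈ U j ↔ y ∈ U j) → ∀ i, x ∈ Set.range (f i) → y ∈ Set.range (f i)),
    clsHom s = ∑ i, clsHom (f i ≫ s) := by
  induction m with
  | zero =>
    intro X s _ U ι _ Y f _ hd hc hs
    rcases isEmpty_or_nonempty X with h | ⟨⟨x⟩⟩
    · rw [clsHom_eq_zero, Finset.sum_eq_zero]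
      intro i _
      have : IsEmpty (Y i) := Function.isEmpty (f i)
      exact clsHom_eq_zero _
    · obtain ⟨i, hi⟩ := Set.mem_iUnion.mp (hc.ge (Set.mem_univ x))
      have hi' : Set.range (f i) = Set.univ :=
        Set.eq_univ_of_forall fun y ↦ hs x y (fun j ↦ j.elim0) i hi
      rw [Finset.sum_eq_single i, clsHom_comp_of_range_eq_univ s (f i) hi']
      · intro j _ hj
        have : IsEmpty (Y j) := by
          have := hd j i hj
          rwa [hi', Set.disjoint_univ, Set.range_eq_empty_iff] at this
        exact clsHom_eq_zero _
      · simp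
  | succ m ih =>
    intro X s _ U ι _ Y f _ hd hc hs
    -- On a subscheme lying entirely inside or outside `U 0`, the remaining `m` open sets already
    -- separate the pieces.
    have key {X' : Scheme.{u}} (g : X' ⟶ X) [IsImmersion g]
        (hU : ∀ x y, g x ∈ U 0 ↔ g y ∈ U 0) :
        clsHom (g ≫ s) = ∑ i, clsHom (pullback.fst (f i) g ≫ f i ≫ s) := by
      have hr (i) : Set.range (pullback.snd (f i) g) = g ⁻¹' Set.range (f i) :=
        Scheme.Pullback.range_snd _ _
      rw [ih (g ≫ s) (fun j ↦ g ⁻¹ᵁ (U j.succ)) _ (fun i ↦ pullback.snd (f i) g)]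
      · exact Finset.sum_congr rfl fun i _ ↦ clsHom_congr (pullback.condition_assoc _).symm
      · intro i j hij
        rw [hr, hr]
        exact (hd i j hij).preimage g
      · simp_rw [hr, ← Set.preimage_iUnion, hc, Set.preimage_univ]
      · intro x y hxy i
        rw [hr]
        exact hs (g x) (g y) (Fin.cases (hU x y) hxy) i
    let Zι := (Scheme.IdealSheafData.vanishingIdeal
      (⟨(U 0 : Set X)ᶜ, (U 0).isOpen.isClosed_compl⟩ : TopologicalSpace.Closeds X)).subschemeι
    have hU : Set.range (U 0).ι = U 0 := (U 0).range_ι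
    have hZ : Set.range Zι = (U 0 : Set X)ᶜ := by
      simp [Zι, Scheme.IdealSheafData.range_subschemeι]
    have hmU (x) : (U 0).ι x ∈ U 0 := hU.le ⟨x, rfl⟩
    have hmZ (x) : Zι x ∉ U 0 := hZ.le ⟨x, rfl⟩
    rw [clsHom_eq_add s (U 0).ι Zι (by rw [hU]; exact (U 0).isOpen) (by rw [hU, hZ, compl_compl]),
      key (U 0).ι (fun x y ↦ by simp only [hmU]), key Zι (fun x y ↦ by simp only [hmZ]),
      ← Finset.sum_add_distrib]
    refine Finset.sum_congr rfl fun i _ ↦ (clsHom_eq_add _ _ _ ?_ ?_).symm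
    · rw [Scheme.Pullback.range_fst, hU]
      exact (U 0).isOpen.preimage (f i).continuous
    · rw [Scheme.Pullback.range_fst, Scheme.Pullback.range_fst, hU, hZ, Set.preimage_compl,
        compl_compl]

/-- The class of a scheme is the sum of the classes of the pieces of a finite partition into
locally closed subschemes. -/
lemma clsHom_eq_sum {ι : Type} [Fintype ι] (Y : ι → Scheme.{u}) (f : ∀ i, Y i ⟶ X)
    [∀ i, IsImmersion (f i)]
    (hd : ∀ i j, i ≠ j → Disjoint (Set.range (f i)) (Set.range (f j)))
    (hc : (⋃ i, Set.range (f i)) = Set.univ) :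
    clsHom s = ∑ i, clsHom (f i ≫ s) := by
  -- A locally closed set is the intersection of its coborder, which is open, with its closure; two
  -- open sets per piece therefore detect membership.
  let e := Fintype.equivFin (ι × Bool)
  let U : ι × Bool → X.Opens
    | (i, true) => (f i).coborderRange
    | (i, false) => ⟨(closure (Set.range (f i)))ᶜ, isClosed_closure.isOpen_compl⟩
  refine clsHom_eq_sum_of_saturated _ s (U ∘ e.symm) Y f hd hc fun x y h i ↦ ?_
  have hr : Set.range (f i) = coborder (Set.range (f i)) ∩ closure (Set.range (f i)) :=
    coborder_inter_closure.symm
  have h₁ : x ∈ coborder (Set.range (f i)) ↔ y ∈ coborder (Set.range (f i)) := by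
    simpa using! h (e (i, true))
  have h₂ : x ∈ (closure (Set.range (f i)))ᶜ ↔ y ∈ (closure (Set.range (f i)))ᶜ := by
    simpa using! h (e (i, false))
  rw [hr]
  exact fun hx ↦ ⟨h₁.mp hx.1, not_not.mp (h₂.not.mp (not_not.mpr hx.2))⟩

end K0

/-- The class of a subset of a `k`-scheme does not depend on the decomposition. -/
lemma IsClassOf.unique {k : Type u} [Field k] {P : Over (Spec (CommRingCat.of k))}
    {C : Set P.left} {c d : K0 k} (hc : IsClassOf P C c) (hd : IsClassOf P C d) : c = d := by
  obtain ⟨n, X, f, hf, hfd, hfC, rfl⟩ := hc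
  obtain ⟨m, Y, g, hg, hgd, hgC, rfl⟩ := hd
  -- Both sums are expanded over the common refinement by fibre products.
  have h₁ (i) : K0.cls (X i) =
      ∑ j, K0.clsHom (pullback.fst (f i).left (g j).left ≫ (X i).obj.hom) := by
    rw [K0.cls_eq_clsHom]
    refine K0.clsHom_eq_sum _ _ _ (fun j j' h ↦ ?_) ?_
    · rw [Scheme.Pullback.range_fst, Scheme.Pullback.range_fst]
      exact (hgd j j' h).preimage _
    · simp_rw [Scheme.Pullback.range_fst, ← Set.preimage_iUnion, hgC, ← hfC]
      exact Set.eq_univ_of_forall fun x ↦ Set.mem_iUnion.mpr ⟨i, x, rfl⟩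
  have h₂ (j) : K0.cls (Y j) =
      ∑ i, K0.clsHom (pullback.snd (f i).left (g j).left ≫ (Y j).obj.hom) := by
    rw [K0.cls_eq_clsHom]
    refine K0.clsHom_eq_sum _ _ _ (fun i i' h ↦ ?_) ?_
    · rw [Scheme.Pullback.range_snd, Scheme.Pullback.range_snd]
      exact (hfd i i' h).preimage _
    · simp_rw [Scheme.Pullback.range_snd, ← Set.preimage_iUnion, hfC, ← hgC]
      exact Set.eq_univ_of_forall fun x ↦ Set.mem_iUnion.mpr ⟨j, x, rfl⟩
  simp_rw [h₁, h₂]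
  rw [Finset.sum_comm]
  refine Finset.sum_congr rfl fun j _ ↦ Finset.sum_congr rfl fun i _ ↦ K0.clsHom_congr ?_
  rw [← Over.w (f i), ← Over.w (g j), pullback.condition_assoc]

end

noncomputable section

open HomogeneousLocalization

/-! ### Classes of affine spaces -/

section AffineSpace

variable (k : Type u) [Field k] (A B : Type u) [CommRing A] [Algebra k A] [CommRing B] [Algebra k B]

/-- The structure morphism of the spectrum of a `k`-algebra. -/
def specHom : Spec (CommRingCat.of A) ⟶ Spec (CommRingCat.of k) :=
  Spec.map (CommRingCat.ofHom (algebraMap k A))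

instance [Algebra.FiniteType k A] : IsFTOver (specHom k A) where
  locallyOfFiniteType := (HasRingHomProperty.Spec_iff (P := @LocallyOfFiniteType)).mpr
    (RingHom.finiteType_algebraMap.mpr inferInstance)
  quasiCompact := by unfold specHom; infer_instance

namespace K0

variable {A B} in
lemma clsHom_specHom_congr [Algebra.FiniteType k A] [Algebra.FiniteType k B] (e : A ≃ₐ[k] B) :
    clsHom (specHom k A) = clsHom (specHom k B) := by
  let f : Spec (CommRingCat.of A) ⟶ Spec (CommRingCat.of B) :=
    Spec.map e.symm.toRingEquiv.toCommRingCatIso.hom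
  have hf : f ≫ specHom k B = specHom k A := by
    rw [specHom, specHom, ← Spec.map_comp]
    congr 1
    ext x
    exact e.symm.commutes x
  rw [← clsHom_comp_of_range_eq_univ (specHom k B) f f.homeomorph.surjective.range_eq]
  exact clsHom_congr hf.symm

lemma lefschetz_eq_clsHom :
    lefschetz k = clsHom (specHom k (MvPolynomial PUnit.{u + 1} k)) := by
  let p : 𝔸(PUnit.{u + 1}; Spec (CommRingCat.of k)) ⟶ Spec (CommRingCat.of k) :=
    𝔸(PUnit.{u + 1}; Spec (CommRingCat.of k)) ↘ Spec (CommRingCat.of k)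
  have : IsFTOver p := ⟨(affineLine k).locallyOfFiniteType, (affineLine k).quasiCompact⟩
  let f : Spec (CommRingCat.of (MvPolynomial PUnit.{u + 1} k)) ⟶
      𝔸(PUnit.{u + 1}; Spec (CommRingCat.of k)) :=
    (AffineSpace.SpecIso PUnit.{u + 1} (CommRingCat.of k)).inv
  have : IsIso f := inferInstanceAs (IsIso (AffineSpace.SpecIso _ _).inv)
  have hf : f ≫ p = specHom k (MvPolynomial PUnit.{u + 1} k) := AffineSpace.SpecIso_inv_over _
  change clsHom p = _
  rw [← clsHom_comp_of_range_eq_univ p f f.homeomorph.surjective.range_eq]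
  exact clsHom_congr hf

attribute [local instance] MvPolynomial.algebraMvPolynomial in
lemma clsHom_specHom_mvPolynomial (σ : Type u) [Finite σ] :
    clsHom (specHom k (MvPolynomial σ k)) = lefschetz k ^ Nat.card σ := by
  suffices ∀ [Finite σ], clsHom (specHom k (MvPolynomial σ k)) = lefschetz k ^ Nat.card σ from this
  induction σ using Finite.induction_empty_option with
  | of_equiv e h =>
    intro _
    have := Finite.of_equiv _ e.symm
    rw [← clsHom_specHom_congr k (MvPolynomial.renameEquiv k e), h, Nat.card_congr e]
  | h_empty =>
    intro _
    rw [clsHom_specHom_congr k (MvPolynomial.isEmptyAlgEquiv k PEmpty)]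
    have : IsIso (specHom k k) := by
      have : CommRingCat.ofHom (algebraMap k k) = 𝟙 (CommRingCat.of k) := rfl
      rw [specHom, this]
      infer_instance
    rw [clsHom_one]
    simp
  | @h_option σ _ h =>
    intro _
    let Q := MvPolynomial PUnit.{u + 1} (MvPolynomial σ k)
    let e : MvPolynomial (Option σ) k ≃ₐ[k] Q :=
      (MvPolynomial.renameEquiv k
        ((Equiv.optionEquivSumPUnit σ).trans (Equiv.sumComm _ _))).trans
        (MvPolynomial.sumAlgEquiv k PUnit.{u + 1} σ)
    have : Algebra.FiniteType k Q := .of_surjective e.toAlgHom e.surjective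
    rw [clsHom_specHom_congr k e, Finite.card_option, pow_succ', ← h, lefschetz_eq_clsHom, mul_comm]
    -- `Q` is the tensor product over `k` of the two polynomial rings, so its spectrum is the
    -- product of the affine spaces.
    have h' : IsPullback (Spec.map (CommRingCat.ofHom (algebraMap (MvPolynomial σ k) Q)))
        (Spec.map (CommRingCat.ofHom (algebraMap (MvPolynomial PUnit.{u + 1} k) Q)))
        (specHom k (MvPolynomial σ k)) (specHom k (MvPolynomial PUnit.{u + 1} k)) :=
      isPullback_SpecMap_of_isPushout _ _ _ _
        (CommRingCat.isPushout_of_isPushout k (MvPolynomial σ k) (MvPolynomial PUnit.{u + 1} k) Q)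
    refine (clsHom_mul _ _ _ _ _ h' ?_).symm
    rw [specHom, specHom, ← Spec.map_comp]
    rfl

end K0

end AffineSpace

/-! ### Coordinate linear subspaces of the standard charts -/

section Chart

attribute [local instance] MvPolynomial.gradedAlgebra

variable {σ : Type u} (k : Type u) [Field k]

/-- The coordinate ring of the chart `x_s ≠ 0` of the projective space. -/
abbrev ChartRing (s : σ) : Type u :=
  Away (MvPolynomial.homogeneousSubmodule σ k) (MvPolynomial.X s)

instance (s : σ) : Algebra k (ChartRing k s) :=
  ((fromZeroRingHom (MvPolynomial.homogeneousSubmodule σ k) _).comp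
    (algebraMap k (MvPolynomial.homogeneousSubmodule σ k 0))).toAlgebra

lemma X_mem_homogeneousSubmodule (s : σ) :
    MvPolynomial.X s ∈ MvPolynomial.homogeneousSubmodule σ k 1 :=
  MvPolynomial.isHomogeneous_X k s

/-- The function `x_t / x_s` on the chart `x_s ≠ 0`. -/
def coordRatio (s t : σ) : ChartRing k s :=
  Away.isLocalizationElem (X_mem_homogeneousSubmodule k s) (X_mem_homogeneousSubmodule k t)

lemma val_algebraMap_chartRing (s : σ) (c : k) :
    (algebraMap k (ChartRing k s) c).val =
      algebraMap _ (Localization.Away (MvPolynomial.X s)) (MvPolynomial.C (σ := σ) c) := by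
  rw [← Localization.mk_one_eq_algebraMap]
  rfl

lemma val_coordRatio (s t : σ) : (coordRatio k s t).val =
    Localization.mk (MvPolynomial.X t)
      (⟨MvPolynomial.X s ^ 1, 1, rfl⟩ : Submonoid.powers (MvPolynomial.X (R := k) s)) := by
  simp [coordRatio, Away.isLocalizationElem, Away.val_mk]

lemma adjoin_X_eq_top :
    Algebra.adjoin (MvPolynomial.homogeneousSubmodule σ k 0)
      (Set.range (MvPolynomial.X : σ → MvPolynomial σ k)) = ⊤ := by
  refine eq_top_iff.mpr fun p _ ↦ ?_
  induction p using MvPolynomial.induction_on with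
  | C c => exact Subalgebra.algebraMap_mem _ (algebraMap k (MvPolynomial.homogeneousSubmodule σ k 0) c)
  | add p q hp hq => exact add_mem (hp trivial) (hq trivial)
  | mul_X p t hp => exact mul_mem (hp trivial) (Algebra.subset_adjoin ⟨t, rfl⟩)

/-- The chart ring is spanned over constants by monomials of degree `a` divided by `x_s ^ a`, and
these are products of ratios `x_t / x_s`. -/
lemma adjoin_coordRatio_eq_top [Finite σ] (s : σ) :
    Algebra.adjoin k (Set.range (coordRatio k s)) = ⊤ := by
  have := Fintype.ofFinite σ
  have h := Away.adjoin_mk_prod_pow_eq_top (X_mem_homogeneousSubmodule k s) σ MvPolynomial.X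
    (adjoin_X_eq_top k) (fun _ ↦ 1) (X_mem_homogeneousSubmodule k)
  refine eq_top_iff.mpr fun p _ ↦ ?_
  induction (eq_top_iff.mp h trivial : p ∈ _) using Algebra.adjoin_induction with
  | mem p hp =>
    obtain ⟨a, b, hab, -, rfl⟩ := hp
    have : Away.mk _ (X_mem_homogeneousSubmodule k s) a (∏ i, MvPolynomial.X i ^ b i)
        (hab ▸ SetLike.prod_pow_mem_graded _ _ _ _ fun i _ ↦ X_mem_homogeneousSubmodule k i) =
        ∏ i, coordRatio k s i ^ b i := by
      apply (show Function.Injective (algebraMap (ChartRing k s)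
        (Localization.Away (MvPolynomial.X (R := k) s))) from val_injective _)
      simp only [map_prod, map_pow, HomogeneousLocalization.algebraMap_apply, val_coordRatio, Away.val_mk,
        Localization.mk_pow, Localization.mk_prod]
      congr 1
      ext1
      simp only [SubmonoidClass.coe_pow, pow_one,
        Finset.prod_pow_eq_pow_sum]
      congr 1
      simpa using hab.symm
    rw [this]
    exact Subalgebra.prod_mem _ fun i _ ↦
      Subalgebra.pow_mem _ (Algebra.subset_adjoin (Set.mem_range_self i)) _
  | algebraMap r =>
    obtain ⟨r, hr⟩ := r
    -- Homogeneous polynomials of degree zero are constants.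
    obtain ⟨c, rfl⟩ : ∃ c, MvPolynomial.C c = r :=
      ⟨_, (MvPolynomial.totalDegree_eq_zero_iff_eq_C.mp
        (MvPolynomial.IsHomogeneous.totalDegree_le hr |>.antisymm (Nat.zero_le _))).symm⟩
    exact Subalgebra.algebraMap_mem _ c
  | add p q _ _ hp hq => exact add_mem (hp trivial) (hq trivial)
  | mul p q _ _ hp hq => exact mul_mem (hp trivial) (hq trivial)

open scoped Classical in
/-- The substitution `x_s = 1` and `x_w = 0` for `w ∈ Z`. -/
def chartSubst (s : σ) (Z : Set σ) :
    MvPolynomial σ k →ₐ[k] MvPolynomial {t // t ∉ insert s Z} k :=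
  MvPolynomial.aeval fun t ↦ if t = s then 1 else
    if h : t ∉ insert s Z then MvPolynomial.X ⟨t, h⟩ else 0

lemma chartSubst_X_self (s : σ) (Z : Set σ) : chartSubst k s Z (MvPolynomial.X s) = 1 := by
  simp [chartSubst]

lemma chartSubst_X (s : σ) (Z : Set σ) (t : {t // t ∉ insert s Z}) :
    chartSubst k s Z (MvPolynomial.X t.1) = MvPolynomial.X t := by
  have h : t.1 ≠ s := fun h ↦ t.2 (.inl h)
  simp only [chartSubst, MvPolynomial.aeval_X, if_neg h, dif_pos t.2]

lemma chartSubst_X_of_mem (s : σ) (Z : Set σ) (hs : s ∉ Z) {t : σ} (ht : t ∈ Z) :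
    chartSubst k s Z (MvPolynomial.X t) = 0 := by
  have h : t ≠ s := fun h ↦ hs (h ▸ ht)
  have h' : ¬ t ∉ insert s Z := not_not.mpr (.inr ht)
  simp only [chartSubst, MvPolynomial.aeval_X, if_neg h, dif_neg h']

/-- The closed subscheme `x_w = 0`, `w ∈ Z`, of the chart `x_s ≠ 0`, on coordinate rings. -/
def chartEval (s : σ) (Z : Set σ) :
    ChartRing k s →ₐ[k] MvPolynomial {t // t ∉ insert s Z} k where
  __ := (Localization.awayLift (chartSubst k s Z).toRingHom (MvPolynomial.X s)
      (by simp [chartSubst_X_self])).comp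
      (algebraMap (ChartRing k s) (Localization.Away (MvPolynomial.X s)))
  commutes' c := by
    change Localization.awayLift (chartSubst k s Z).toRingHom _ (by simp [chartSubst_X_self])
      (algebraMap k (ChartRing k s) c).val = _
    rw [val_algebraMap_chartRing, Localization.awayLift,
      IsLocalization.Away.lift_eq]
    simp [MvPolynomial.algebraMap_eq]

lemma chartEval_coordRatio (s : σ) (Z : Set σ) (t : σ) :
    chartEval k s Z (coordRatio k s t) = chartSubst k s Z (MvPolynomial.X t) := by
  change Localization.awayLift (chartSubst k s Z).toRingHom _ (by simp [chartSubst_X_self])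
    (coordRatio k s t).val = _
  rw [val_coordRatio]
  refine (Localization.awayLift_mk _ _ _ 1 (by simp [chartSubst_X_self]) 1).trans ?_
  simp

lemma chartEval_aeval (s : σ) (Z : Set σ) (p : MvPolynomial {t // t ∉ insert s Z} k) :
    chartEval k s Z (MvPolynomial.aeval (fun t ↦ coordRatio k s t.1) p) = p := by
  rw [← AlgHom.comp_apply]
  suffices (chartEval k s Z).comp (MvPolynomial.aeval fun t ↦ coordRatio k s t.1) =
    AlgHom.id k _ from congr($this p)
  ext t : 1
  simp [chartEval_coordRatio, chartSubst_X]

lemma chartEval_surjective (s : σ) (Z : Set σ) : Function.Surjective (chartEval k s Z) :=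
  fun p ↦ ⟨_, chartEval_aeval k s Z p⟩

lemma coordRatio_self (s : σ) : coordRatio k s s = 1 := by
  apply (show Function.Injective (algebraMap (ChartRing k s)
    (Localization.Away (MvPolynomial.X (R := k) s))) from val_injective _)
  rw [HomogeneousLocalization.algebraMap_apply, val_coordRatio, map_one]
  simp

/-- Modulo the ideal of the ratios in `Z`, evaluation followed by its section `x_t ↦ x_t / x_s`
fixes the generators of the chart ring, hence is the identity; so whatever evaluates to zero lies in
the ideal. -/
lemma ker_chartEval [Finite σ] (s : σ) (Z : Set σ) (hs : s ∉ Z) :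
    RingHom.ker (chartEval k s Z) = Ideal.span (coordRatio k s '' Z) := by
  refine le_antisymm (fun a ha ↦ ?_) ?_
  · let I := Ideal.span (coordRatio k s '' Z)
    have h : (Ideal.Quotient.mkₐ k I).comp
        ((MvPolynomial.aeval fun t : {t // t ∉ insert s Z} ↦ coordRatio k s t.1).comp
          (chartEval k s Z)) = Ideal.Quotient.mkₐ k I := by
      refine AlgHom.ext_of_adjoin_eq_top (adjoin_coordRatio_eq_top k s) ?_
      rintro _ ⟨t, rfl⟩
      simp only [AlgHom.comp_apply, chartEval_coordRatio]
      by_cases ht : t ∉ insert s Z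
      · rw [chartSubst_X k s Z ⟨t, ht⟩, MvPolynomial.aeval_X]
      · obtain rfl | ht := not_not.mp ht
        · rw [chartSubst_X_self, coordRatio_self, map_one]
        · rw [chartSubst_X_of_mem k s Z hs ht, map_zero, map_zero, eq_comm]
          exact Ideal.Quotient.eq_zero_iff_mem.mpr (Ideal.subset_span ⟨t, ht, rfl⟩)
    have h' := congr($h a)
    simp only [AlgHom.comp_apply, (RingHom.mem_ker).mp ha, map_zero] at h'
    exact Ideal.Quotient.eq_zero_iff_mem.mp h'.symm
  · rw [Ideal.span_le]
    rintro _ ⟨w, hw, rfl⟩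
    exact (chartEval_coordRatio k s Z w).trans (chartSubst_X_of_mem k s Z hs hw)

/-- The affine space `x_s ≠ 0`, `x_w = 0` for `w ∈ Z`, inside the projective space. -/
def linearChart (s : σ) (Z : Set σ) :
    Spec (CommRingCat.of (MvPolynomial {t // t ∉ insert s Z} k)) ⟶ projSpace σ k :=
  Spec.map (CommRingCat.ofHom (chartEval k s Z).toRingHom) ≫
    Proj.awayι _ _ (X_mem_homogeneousSubmodule k s) one_pos

instance (s : σ) (Z : Set σ) : IsImmersion (linearChart k s Z) := by
  have := IsClosedImmersion.spec_of_surjective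
    (CommRingCat.ofHom (chartEval k s Z).toRingHom) (chartEval_surjective k s Z)
  unfold linearChart projSpace
  infer_instance

lemma linearChart_comp_projSpaceHom (s : σ) (Z : Set σ) :
    linearChart k s Z ≫ projSpaceHom σ k = specHom k _ := by
  unfold linearChart projSpaceHom projSpace
  rw [Category.assoc, Proj.awayι_toSpecZero_assoc, specHom, ← Spec.map_comp, ← Spec.map_comp]
  exact congr(Spec.map (CommRingCat.ofHom $((chartEval k s Z).comp_algebraMap)))

lemma range_linearChart [Finite σ] (s : σ) (Z : Set σ) (hs : s ∉ Z) :
    Set.range (linearChart k s Z) =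
      {x | x ∈ coordOpen σ k s ∧ ∀ w ∈ Z, x ∉ coordOpen σ k w} := by
  have h₁ : Set.range (Spec.map (CommRingCat.ofHom (chartEval k s Z).toRingHom)) =
      PrimeSpectrum.zeroLocus (coordRatio k s '' Z) := by
    refine (range_comap_of_surjective _ _ (chartEval_surjective k s Z)).trans ?_
    rw [← PrimeSpectrum.zeroLocus_span (coordRatio k s '' Z), ← ker_chartEval k s Z hs]
    rfl
  let ι : Spec (CommRingCat.of (ChartRing k s)) ⟶ projSpace σ k :=
    Proj.awayι (MvPolynomial.homogeneousSubmodule σ k) _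
      (X_mem_homogeneousSubmodule k s) one_pos
  have h₂ : Set.range ι = (coordOpen σ k s : Set (projSpace σ k)) :=
    congr(($(Proj.opensRange_awayι (MvPolynomial.homogeneousSubmodule σ k) _
      (X_mem_homogeneousSubmodule k s) one_pos)).carrier)
  have h₃ (w) (y) : ι y ∈ coordOpen σ k w ↔ coordRatio k s w ∉ y.asIdeal :=
    (congr(y ∈ $(Proj.awayι_preimage_basicOpen (MvPolynomial.homogeneousSubmodule σ k)
      (X_mem_homogeneousSubmodule k s) one_pos (X_mem_homogeneousSubmodule k w) one_pos))).to_iff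
  have h₄ : Set.range (linearChart k s Z) =
      ι '' Set.range (Spec.map (CommRingCat.ofHom (chartEval k s Z).toRingHom)) := by
    rw [← Set.range_comp]
    rfl
  rw [h₄, h₁]
  ext x
  constructor
  · rintro ⟨y, hy, rfl⟩
    refine ⟨h₂.le ⟨y, rfl⟩, fun w hw ↦ ?_⟩
    rw [h₃, not_not]
    exact hy ⟨w, hw, rfl⟩
  · rintro ⟨hx, hx'⟩
    obtain ⟨y, rfl⟩ := h₂.ge hx
    refine ⟨y, ?_, rfl⟩
    rintro _ ⟨w, hw, rfl⟩
    exact not_not.mp ((h₃ w y).not.mp (hx' w hw))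

end Chart

end

noncomputable section

/-! ### Tori and strata by support -/

section Strata

variable {σ : Type u} (k : Type u) [Field k]

/-- The subset `C` of the projective space is locally closed, and its class is a polynomial in
the class of the affine line. -/
def HasTateClass (C : Set (projSpace σ k)) : Prop :=
  ∃ (X : Scheme.{u}) (f : X ⟶ projSpace σ k) (_ : IsImmersion f)
    (_ : IsFTOver (f ≫ projSpaceHom σ k)), Set.range f = C ∧
      K0.clsHom (f ≫ projSpaceHom σ k) ∈ Algebra.adjoin ℤ {K0.lefschetz k}

/-- The points with `x_s ≠ 0` whose coordinates are zero on `Z` and nonzero on `N`. -/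
def torusChart (s : σ) (Z : Set σ) (N : Finset σ) : Set (projSpace σ k) :=
  {x | x ∈ coordOpen σ k s ∧ (∀ w ∈ Z, x ∉ coordOpen σ k w) ∧ ∀ w ∈ N, x ∈ coordOpen σ k w}

/-- The points whose nonzero coordinates are those in `S`. -/
def supportStratum (S : Finset σ) : Set (projSpace σ k) :=
  {x | ∀ w, x ∈ coordOpen σ k w ↔ w ∈ S}

variable {k} in
-- `[C ∩ U] = [C] - [C \ U]`, and `ℤ[𝕃]` is closed under subtraction.
lemma HasTateClass.sdiff {C D : Set (projSpace σ k)} (hC : HasTateClass k C)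
    (hD : HasTateClass k D) (U : (projSpace σ k).Opens) (hU : D = C \ U) :
    HasTateClass k (C ∩ U) := by
  obtain ⟨X, f, hf, hX, rfl, hX'⟩ := hC
  obtain ⟨Y, g, hg, hY, hgD, hY'⟩ := hD
  let V : X.Opens := f ⁻¹ᵁ U
  have hV : Set.range V.ι = f ⁻¹' U := V.range_ι
  have hfst : Set.range (pullback.fst f g) = (f ⁻¹' U)ᶜ := by
    rw [Scheme.Pullback.range_fst, hgD, hU, Set.preimage_sdiff, Set.preimage_range,
      Set.compl_eq_univ_sdiff]
  have hsnd : Set.range (pullback.snd f g) = Set.univ := by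
    rw [Scheme.Pullback.range_snd, Set.eq_univ_iff_forall]
    intro y
    exact ((hgD.trans hU).le ⟨y, rfl⟩).1
  have key := K0.clsHom_eq_add (f ≫ projSpaceHom σ k) V.ι (pullback.fst f g)
    (by rw [hV]; exact V.isOpen) (by rw [hV, hfst, compl_compl])
  have hZ : K0.clsHom (pullback.fst f g ≫ f ≫ projSpaceHom σ k) =
      K0.clsHom (g ≫ projSpaceHom σ k) := by
    rw [← K0.clsHom_comp_of_range_eq_univ (g ≫ projSpaceHom σ k) (pullback.snd f g) hsnd]
    exact K0.clsHom_congr (pullback.condition_assoc _)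
  have hft : IsFTOver ((V.ι ≫ f) ≫ projSpaceHom σ k) := by
    rw [Category.assoc]; infer_instance
  refine ⟨_, V.ι ≫ f, inferInstance, hft, ?_, ?_⟩
  · have : Set.range (V.ι ≫ f) = f '' Set.range V.ι := by
      rw [← Set.range_comp]; rfl
    rw [this, hV, Set.image_preimage_eq_range_inter]
  · rw [K0.clsHom_congr (Category.assoc _ _ _), ← sub_eq_of_eq_add key, hZ]
    exact sub_mem hX' hY'

variable [Finite σ]

lemma hasTateClass_torusChart_empty (s : σ) (Z : Set σ) (hs : s ∉ Z) :
    HasTateClass k (torusChart k s Z ∅) := by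
  have h := linearChart_comp_projSpaceHom k s Z
  have hft : IsFTOver (linearChart k s Z ≫ projSpaceHom σ k) := by rw [h]; infer_instance
  refine ⟨_, linearChart k s Z, inferInstance, hft, ?_, ?_⟩
  · rw [range_linearChart k s Z hs]
    simp [torusChart]
  · rw [K0.clsHom_congr h, K0.clsHom_specHom_mvPolynomial]
    exact pow_mem (Algebra.self_mem_adjoin_singleton ℤ _) _

/-- Induction on `N`: requiring `x_w ≠ 0` removes the locus `x_w = 0`, where `w` has joined `Z`.
Hence the induction hypothesis must hold for all `Z`. -/
lemma hasTateClass_torusChart (s : σ) (N : Finset σ) (hN : s ∉ N) :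
    ∀ (Z : Set σ), s ∉ Z → HasTateClass k (torusChart k s Z N) := by
  classical
  induction N using Finset.induction_on with
  | empty => exact hasTateClass_torusChart_empty k s
  | insert w N _ ih =>
    intro Z hZ
    obtain ⟨hw, hN'⟩ := not_or.mp (Finset.mem_insert.not.mp hN)
    have h := (ih hN' Z hZ).sdiff (ih hN' (insert w Z) (by simp [hw, hZ])) (coordOpen σ k w) (by
      ext x
      simp only [torusChart, Set.forall_mem_insert, Set.mem_ofPred_eq, Set.mem_sdiff,
        SetLike.mem_coe]
      tauto)
    convert h using 1
    ext x
    simp only [torusChart, Finset.forall_mem_insert, Set.mem_ofPred_eq, Set.mem_inter_iff,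
      SetLike.mem_coe]
    tauto

/-- Any `s ∈ S` provides a chart containing the whole stratum. -/
lemma hasTateClass_supportStratum (S : Finset σ) (hS : S.Nonempty) :
    HasTateClass k (supportStratum k S) := by
  classical
  obtain ⟨s, hs⟩ := hS
  convert hasTateClass_torusChart k s (S.erase s) (by simp) (Sᶜ : Set σ) (by simpa) using 1
  ext x
  simp only [supportStratum, torusChart, Set.mem_ofPred_eq, Set.mem_compl_iff, Finset.mem_erase,
    Finset.mem_coe]
  refine ⟨fun h ↦ ⟨(h s).mpr hs, fun w hw ↦ (h w).not.mpr hw, fun w hw ↦ (h w).mpr hw.2⟩, ?_⟩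
  rintro ⟨h₁, h₂, h₃⟩ w
  refine ⟨fun h ↦ not_not.mp fun hw ↦ h₂ w hw h, fun hw ↦ ?_⟩
  by_cases h : w = s
  · exact h ▸ h₁
  · exact h₃ w ⟨h, hw⟩

/-- A set of points that is described by the vanishing of coordinates has a class, which is a
polynomial in the class of the affine line. -/
lemma exists_isClassOf_of_saturated (C : Set (projSpace σ k))
    (hC : ∀ x ∈ C, ∃ s, x ∈ coordOpen σ k s)
    (hsat : ∀ x y, (∀ s, x ∈ coordOpen σ k s ↔ y ∈ coordOpen σ k s) → x ∈ C → y ∈ C) :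
    ∃ c ∈ Algebra.adjoin ℤ {K0.lefschetz k}, IsClassOf (projSpaceOver σ k) C c := by
  classical
  have := Fintype.ofFinite σ
  -- Only supports attained in `C` are used; `hC` makes them nonempty, and `hsat` puts their whole
  -- strata inside `C`.
  let ι := {S : Finset σ // ∃ x ∈ C, x ∈ supportStratum k S}
  have hι (S : ι) : HasTateClass k (supportStratum k S.1) := by
    obtain ⟨S, x, hx, hxS⟩ := S
    obtain ⟨s, hs⟩ := hC x hx
    exact hasTateClass_supportStratum k S ⟨s, (hxS s).mp hs⟩
  choose X f hf hX hr hc using hι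
  let e := Fintype.equivFin ι
  refine ⟨∑ i, K0.clsHom (f (e.symm i) ≫ projSpaceHom σ k), sum_mem fun i _ ↦ hc _, _,
    fun i ↦ ⟨Over.mk (f (e.symm i) ≫ projSpaceHom σ k), (hX _).1, (hX _).2⟩,
    fun i ↦ Over.homMk (f (e.symm i)), fun i ↦ hf _, fun i j hij ↦ ?_, ?_, rfl⟩
  · change Disjoint (Set.range (f (e.symm i))) (Set.range (f (e.symm j)))
    rw [hr, hr, Set.disjoint_left]
    intro x hx hx'
    exact hij (e.symm.injective (Subtype.ext (Finset.ext fun w ↦ (hx w).symm.trans (hx' w))))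
  · change ⋃ i, Set.range (f (e.symm i)) = C
    simp_rw [hr]
    ext x
    rw [Set.mem_iUnion]
    constructor
    · rintro ⟨i, hi⟩
      obtain ⟨y, hy, hy'⟩ := (e.symm i).2
      exact hsat y x (fun s ↦ (hy' s).trans (hi s).symm) hy
    · intro hx
      have hxS : x ∈ supportStratum k {w | x ∈ coordOpen σ k w} := fun w ↦ by simp
      exact ⟨e ⟨_, x, hx, hxS⟩, by simpa using hxS⟩

end Strata

/-! ### The set of a loose graph as a union of strata -/

namespace LooseGraph

variable {V E : Type u} (Γ : LooseGraph V E) (k : Type u) [Field k]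

lemma functorF_saturated (x y : projSpace Γ.Vert k)
    (h : ∀ s, x ∈ coordOpen Γ.Vert k s ↔ y ∈ coordOpen Γ.Vert k s) (hx : x ∈ Γ.functorF k) :
    y ∈ Γ.functorF k := by
  simpa only [functorF, starAffine, vertexPoint, Set.mem_sdiff, Set.mem_iUnion, Set.mem_ofPred_eq,
    h] using hx

lemma exists_mem_coordOpen_of_mem_functorF (x : projSpace Γ.Vert k) (hx : x ∈ Γ.functorF k) :
    ∃ v, x ∈ coordOpen Γ.Vert k v := by
  obtain ⟨v, hv⟩ := Set.mem_iUnion.mp hx.1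
  exact ⟨v, hv.1⟩

end LooseGraph

end

/-- For every finite loose graph `Γ` and every finite field `k`, the class of `F_k(Γ)` in
`K₀(Sch_k)` is well defined and lies in the subring `ℤ[𝕃]`. -/
theorem theorem1p1 {V E : Type u} [Finite V] [Finite E] (Γ : LooseGraph V E)
    (k : Type u) [Field k] [Finite k] :
    (∃! c : K0 k, IsClassOf (projSpaceOver Γ.Vert k) (Γ.functorF k) c) ∧
      ∀ c : K0 k, IsClassOf (projSpaceOver Γ.Vert k) (Γ.functorF k) c →
        c ∈ Algebra.adjoin ℤ {K0.lefschetz k} := by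
  obtain ⟨c, hc, hcF⟩ := exists_isClassOf_of_saturated k (Γ.functorF k)
    (Γ.exists_mem_coordOpen_of_mem_functorF k) (Γ.functorF_saturated k)
  exact ⟨⟨c, hcF, fun d hd ↦ hd.unique hcF⟩, fun d hd ↦ hd.unique hcF ▸ hc⟩
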